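/- **Theorem 1 (Robust solvability condition for AC optimal power flow).** *Network.* Consider a network with finitely many buses, lines, generators and loads. Line $l$ runs from bus $\mathrm f(l)$ to a different bus $\mathrm t(l)$; one bus is the reference bus, with phase angle $0$. Buses with a generator are PV buses, all others are PQ buses. A dispatch point is $u=(p_{\mathrm{g,ref}},v_{\mathrm g})$, where generators at a common bus have a common voltage set point; the uncertain injections are $w=(p_{\mathrm d},q_{\mathrm d})$; the internal state is $x=(\theta_{\mathrm{ns}},v_{\mathrm{pq}},\Delta)$ (phase angles at non-reference buses, voltage magnitudes at PQ buses, power imbalance). At PV buses $v_k$ is the set point in $v_{\mathrm g}$. Write $v^{\mathrm f}_l,v^{\mathrm t}_l$ for the voltages at the ends of line $l$ and $\varphi_l=\theta_{\mathrm f(l)}-\theta_{\mathrm t(l)}$. Let $C_{\mathrm g},C_{\mathrm d}$ be the $0/1$ connection matrices of generators and loads, $E$ the bus-line incidence matrix, $\alpha$ the vector of participation factors, $G^{\mathrm c},G^{\mathrm s},B^{\mathrm c},B^{\mathrm s}$ real bus-by-line matrices and $G^{\mathrm d},B^{\mathrm d}$ real diagonal matrices. We say that $x$ solves the AC power flow equations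 for $(u,w)$ if for some reactive generation $q_{\mathrm g}$ and every bus $k$ $$\sum_i C_{\mathrm g,ki}(p_{\mathrm{g,ref},i}+\alpha_i\Delta)-\sum_i C_{\mathrm d,ki}p_{\mathrm d,i}=\sum_l v^{\mathrm f}_lv^{\mathrm t}_l(G^{\mathrm c}_{kl}\cos\varphi_l+B^{\mathrm s}_{kl}\sin\varphi_l)+G^{\mathrm d}_{kk}v_k^2,$$ $$\sum_i C_{\mathrm g,ki}q_{\mathrm g,i}-\sum_i C_{\mathrm d,ki}q_{\mathrm d,i}=\sum_l v^{\mathrm f}_lv^{\mathrm t}_l(G^{\mathrm s}_{kl}\sin\varphi_l-B^{\mathrm c}_{kl}\cos\varphi_l)-B^{\mathrm d}_{kk}v_k^2.$$ *Linearization.* Let $\psi(x,u)=\big((p_{\mathrm{g,ref},i}+\alpha_i\Delta)_i,(v^{\mathrm f}_lv^{\mathrm t}_l\cos\varphi_l)_l,(v^{\mathrm f}_lv^{\mathrm t}_l\sin\varphi_l)_l,(v_k^2)_k\big)$, $$M=\begin{bmatrix}C_{\mathrm g}&-G^{\mathrm c}&-B^{\mathrm s}&-G^{\mathrm d}\\ 0&B^{\mathrm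 c}_{\mathrm{pq}}&-G^{\mathrm s}_{\mathrm{pq}}&B^{\mathrm d}_{\mathrm{pq}}\end{bmatrix},\qquad R=-\begin{bmatrix}C_{\mathrm d}&0\\0&C_{\mathrm{d,pq}}\end{bmatrix},\qquad A=\mathrm{blkdiag}(E_{\mathrm{ns}}^T,I,1),$$ where the index pq (ns) selects the rows of PQ (non-reference) buses, and $f(x,u,w)=M\psi(x,u)+Rw$. Let $(x^{(0)},u^{(0)})$ be a base point at which the Jacobian $J=\nabla_xf$ is nonsingular, let $J_\psi=\nabla_x\psi$ at that point, let $g(x,u)=\psi(x,u)-J_\psi x$ be the residual, with components $g^{\mathrm p}_i,g^{\cos}_l,g^{\sin}_l,g^{\mathrm v}_k$, and let $K=-AJ^{-1}M$ with entrywise parts $K^+=\max\{K,0\}$, $K^-=\min\{K,0\}$. *Uncertainty.* Let $w^{(0)}$ be given, $\Sigma$ positive definite with $\Sigma=\Sigma^{1/2}(\Sigma^{1/2})^T$, $\gamma\ge0$, and $\mathcal W(\gamma)=\{w\mid(w-w^{(0)})^T\Sigma^{-1}(w-w^{(0)})\le\gamma^2\}$. *Envelopes.* Let intervals (operational limits)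 for every $p_{\mathrm{g,ref},i}$, $v_k$ and $\varphi_l$ be given. For every component of $g$ let a concave lower and a convex upper bounding function be given, $g^{\mathrm p,\ell}_i,g^{\mathrm p,u}_i$ of $p_{\mathrm{g,ref},i}$, $g^{\cos,\ell}_l,g^{\cos,u}_l,g^{\sin,\ell}_l,g^{\sin,u}_l$ of $(v^{\mathrm f}_l,v^{\mathrm t}_l,\varphi_l)$, and $g^{\mathrm v,\ell}_k,g^{\mathrm v,u}_k$ of $v_k$, which enclose that component of $g(x,u)$ for all $(x,u)$ for which these arguments are within the limits. *Claim.* Fix a dispatch point $u$. Let $z^u=(\varphi^u,v^u_{\mathrm{pq}},\Delta^u)$ and $z^\ell=(\varphi^\ell,v^\ell_{\mathrm{pq}},\Delta^\ell)$ be bounds, put $v_k^u=v_k^\ell=v_k$ (the set point) at PV buses, and suppose that all $p_{\mathrm{g,ref},i}$, $v_k^\ell$, $v_k^u$, $\varphi_l^\ell$, $\varphi_l^u$ are within the limits. Suppose that vectors $g^u_{\mathcal P},g^\ell_{\mathcal P}$ satisfy, for all $i,l,k$ and all $v^{\mathrm f}_l\in\{v^{\mathrm f,\ell}_l,v^{\mathrm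 f,u}_l\}$, $v^{\mathrm t}_l\in\{v^{\mathrm t,\ell}_l,v^{\mathrm t,u}_l\}$, $\varphi_l\in\{\varphi^\ell_l,\varphi^u_l\}$, $v_k\in\{v_k^\ell,v_k^u\}$, $$g^{\mathrm p,\ell}_{\mathcal P,i}\le g^{\mathrm p,\ell}_i(p_{\mathrm{g,ref},i}),\quad g^{\mathrm p,u}_i(p_{\mathrm{g,ref},i})\le g^{\mathrm p,u}_{\mathcal P,i},\qquad g^{\mathrm v,\ell}_{\mathcal P,k}\le g^{\mathrm v,\ell}_k(v_k),\quad g^{\mathrm v,u}_k(v_k)\le g^{\mathrm v,u}_{\mathcal P,k},$$ $$g^{\bullet,\ell}_{\mathcal P,l}\le g^{\bullet,\ell}_l(v^{\mathrm f}_l,v^{\mathrm t}_l,\varphi_l),\quad g^{\bullet,u}_l(v^{\mathrm f}_l,v^{\mathrm t}_l,\varphi_l)\le g^{\bullet,u}_{\mathcal P,l}\qquad(\bullet\in\{\cos,\sin\}),$$ and $$K^+g^u_{\mathcal P}+K^-g^\ell_{\mathcal P}+\xi^u(\gamma)\le z^u,\qquad K^+g^\ell_{\mathcal P}+K^-g^u_{\mathcal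 P}+\xi^\ell(\gamma)\ge z^\ell,$$ where $\xi^u_i(\gamma)=-A_iJ^{-1}Rw^{(0)}+\gamma\lVert A_iJ^{-1}R\Sigma^{1/2}\rVert_2$ and $\xi^\ell_i(\gamma)=-A_iJ^{-1}Rw^{(0)}-\gamma\lVert A_iJ^{-1}R\Sigma^{1/2}\rVert_2$, with $A_i$ the $i$-th row of $A$. Then for every $w\in\mathcal W(\gamma)$ there is $x\in\mathcal P(z^u,z^\ell)=\{x\mid z^\ell\le Ax\le z^u\}$ that solves the AC power flow equations for $(u,w)$. -/

import Mathlib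

/-- An AC power network with buses `B`, lines `L`, generators `G` and loads `D`. The (arbitrary)
matrices `Gc Gs Bc Bs` are the transformed admittance matrices of the lines; `Gd k` and `Bd k` are
the diagonal entries `G^d_kk`, `B^d_kk`. -/
structure PowerNetwork (B L G D : Type*) where
  fromBus : L → B
  toBus : L → B
  fromBus_ne_toBus : ∀ l, fromBus l ≠ toBus l
  /-- the bus whose phase angle is set to zero -/
  ref : B
  genBus : G → B
  loadBus : D → B
  /-- participation factors of the generators -/
  α : G → ℝ
  Gc : Matrix B L ℝ
  Gs : Matrix B L ℝ
  Bc : Matrix B L ℝ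
  Bs : Matrix B L ℝ
  Gd : B → ℝ
  Bd : B → ℝ

namespace PowerNetwork

variable {B L G D : Type*}

/-- Non-reference buses. -/
abbrev NS (N : PowerNetwork B L G D) : Type _ := {k : B // k ≠ N.ref}

/-- PQ buses: the buses without a generator. All other buses are PV buses. -/
abbrev PQ (N : PowerNetwork B L G D) : Type _ := {k : B // ∀ i, N.genBus i ≠ k}

/-- Index set of the internal state `x = (θ_ns, v_pq, Δ)`. -/
abbrev XIdx (N : PowerNetwork B L G D) : Type _ := N.NS ⊕ (N.PQ ⊕ Unit)

/-- Index set of the transformed state `z = (φ, v_pq, Δ)`. -/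
abbrev ZIdx (N : PowerNetwork B L G D) : Type _ := L ⊕ (N.PQ ⊕ Unit)

/-- Index set of the power flow equations: active power at all buses, reactive power at PQ buses. -/
abbrev FIdx (N : PowerNetwork B L G D) : Type _ := B ⊕ N.PQ

/-- Index set of the basis functions `ψ = (ψ^p, ψ^cos, ψ^sin, ψ^quad)`. -/
abbrev PsiIdx (_N : PowerNetwork B L G D) : Type _ := G ⊕ (L ⊕ (L ⊕ B))

/-- A dispatch point `u = (p_g,ref, v_g)`. Generators at a common bus hold a common voltage. -/
structure Dispatch (N : PowerNetwork B L G D) where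
  pRef : G → ℝ
  vg : G → ℝ
  vg_eq : ∀ i j, N.genBus i = N.genBus j → vg i = vg j

section States

variable (N : PowerNetwork B L G D)

open Classical in
/-- Completes a vector of values at the PQ buses by the voltage set points at the PV buses. -/
noncomputable def withSetpoints (u : N.Dispatch) (y : N.PQ → ℝ) (k : B) : ℝ :=
  if h : ∃ i, N.genBus i = k then u.vg h.choose else y ⟨k, not_exists.mp h⟩

/-- The voltage magnitude at each bus. -/
noncomputable def volt (x : N.XIdx → ℝ) (u : N.Dispatch) : B → ℝ :=
  N.withSetpoints u fun k => x (Sum.inr (Sum.inl k))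

open Classical in
/-- The phase angle at each bus. -/
noncomputable def angle (x : N.XIdx → ℝ) (k : B) : ℝ :=
  if h : k ≠ N.ref then x (Sum.inl ⟨k, h⟩) else 0

/-- The angle difference `φ_l` along a line. -/
noncomputable def phi (x : N.XIdx → ℝ) (l : L) : ℝ :=
  N.angle x (N.fromBus l) - N.angle x (N.toBus l)

/-- The power imbalance `Δ`. -/
def imbalance (x : N.XIdx → ℝ) : ℝ := x (Sum.inr (Sum.inr ()))

/-- The basis functions `ψ(x, u)`. -/
noncomputable def psi (x : N.XIdx → ℝ) (u : N.Dispatch) : N.PsiIdx → ℝ :=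
  Sum.elim (fun i => u.pRef i + N.α i * N.imbalance x)
    (Sum.elim
      (fun l => N.volt x u (N.fromBus l) * N.volt x u (N.toBus l) * Real.cos (N.phi x l))
      (Sum.elim
        (fun l => N.volt x u (N.fromBus l) * N.volt x u (N.toBus l) * Real.sin (N.phi x l))
        (fun k => N.volt x u k ^ 2)))

end States

section Matrices

variable [DecidableEq B] (N : PowerNetwork B L G D)

/-- The incidence matrix `E` of the grid. -/
def incidence : Matrix B L ℝ :=
  Matrix.of fun k l => (if N.fromBus l = k then 1 else 0) - (if N.toBus l = k then 1 else 0)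

/-- The connection matrix `C_g` of the generators. -/
def Cg : Matrix B G ℝ := Matrix.of fun k i => if N.genBus i = k then 1 else 0

/-- The connection matrix `C_d` of the loads. -/
def Cd : Matrix B D ℝ := Matrix.of fun k i => if N.loadBus i = k then 1 else 0

/-- `A = blkdiag(E_nsᵀ, I, 1)`. -/
def A : Matrix N.ZIdx N.XIdx ℝ :=
  Matrix.fromBlocks (N.incidence.submatrix Subtype.val id).transpose 0 0 1

/-- The coefficient matrix `M` of the basis functions. -/
def M : Matrix N.FIdx N.PsiIdx ℝ :=
  Matrix.fromBlocks
    N.Cg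
    (Matrix.fromCols (-N.Gc) (Matrix.fromCols (-N.Bs) (-Matrix.diagonal N.Gd)))
    0
    (Matrix.fromCols (N.Bc.submatrix Subtype.val id)
      (Matrix.fromCols (-N.Gs.submatrix Subtype.val id)
        ((Matrix.diagonal N.Bd).submatrix Subtype.val id)))

/-- The coefficient matrix `R` of the uncertain injections. -/
def R : Matrix N.FIdx (D ⊕ D) ℝ :=
  -Matrix.fromBlocks N.Cd 0 0 (N.Cd.submatrix Subtype.val id)

end Matrices

section PowerFlow

variable [Fintype L] [Fintype G] [Fintype D] [DecidableEq B] (N : PowerNetwork B L G D)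

/-- `x` solves the AC power flow equations for the dispatch point `u` and the uncertain injections
`w = (p_d, q_d)`: with generation `p_g,i = p_g,ref,i + α_i Δ` and with some reactive generation
`q_g`, active and reactive power are balanced at every bus. -/
def SolvesPowerFlow (x : N.XIdx → ℝ) (u : N.Dispatch) (w : D ⊕ D → ℝ) : Prop :=
  ∃ qg : G → ℝ, ∀ k : B,
    ((∑ i, N.Cg k i * (u.pRef i + N.α i * N.imbalance x)) - ∑ i, N.Cd k i * w (Sum.inl i) =
      (∑ l, N.volt x u (N.fromBus l) * N.volt x u (N.toBus l) *
        (N.Gc k l * Real.cos (N.phi x l) + N.Bs k l * Real.sin (N.phi x l)))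
      + N.Gd k * N.volt x u k ^ 2) ∧
    ((∑ i, N.Cg k i * qg i) - ∑ i, N.Cd k i * w (Sum.inr i) =
      (∑ l, N.volt x u (N.fromBus l) * N.volt x u (N.toBus l) *
        (N.Gs k l * Real.sin (N.phi x l) - N.Bc k l * Real.cos (N.phi x l)))
      - N.Bd k * N.volt x u k ^ 2)

end PowerFlow

end PowerNetwork

/-- The Jacobian matrix of `h` at `x`. -/
noncomputable def jacobian {m n : Type*} [Fintype m] [Fintype n] [DecidableEq n]
    (h : (n → ℝ) → (m → ℝ)) (x : n → ℝ) : Matrix m n ℝ :=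
  LinearMap.toMatrix' (fderiv ℝ h x : (n → ℝ) →ₗ[ℝ] (m → ℝ))

section Inverse

variable {m n : Type*} [Fintype m] [Fintype n] [DecidableEq m] [DecidableEq n]

/-- A matrix whose rows and columns are indexed by different types is nonsingular if it has a
two-sided inverse. -/
def Nonsingular (J : Matrix m n ℝ) : Prop :=
  ∃ J' : Matrix n m ℝ, J * J' = 1 ∧ J' * J = 1

open Classical in
/-- The inverse of a nonsingular matrix. -/
noncomputable def matInv (J : Matrix m n ℝ) : Matrix n m ℝ :=
  if h : Nonsingular J then h.choose else 0

end Inverse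

/-- The entrywise positive part `K⁺`. -/
noncomputable def posPartMat {m n : Type*} (K : Matrix m n ℝ) : Matrix m n ℝ := K.map (max · 0)

/-- The entrywise (nonpositive) negative part `K⁻`. -/
noncomputable def negPartMat {m n : Type*} (K : Matrix m n ℝ) : Matrix m n ℝ := K.map (min · 0)

/-- The confidence ellipsoid `W(γ)` with centre `w0` and covariance matrix `Σ`. -/
def confidenceEllipsoid {d : Type*} [Fintype d] [DecidableEq d]
    (Sig : Matrix d d ℝ) (w0 : d → ℝ) (γ : ℝ) : Set (d → ℝ) :=
  {w | (w - w0) ⬝ᵥ Matrix.mulVec Sig⁻¹ (w - w0) ≤ γ ^ 2}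

/-- Limits on generator set points, voltage magnitudes and angle differences. -/
structure OperationalLimits (B L G : Type*) where
  pMin : G → ℝ
  pMax : G → ℝ
  vMin : B → ℝ
  vMax : B → ℝ
  phiMin : L → ℝ
  phiMax : L → ℝ

/-- The range of `(v_l^f, v_l^t, φ_l)` permitted by the limits. -/
def OperationalLimits.lineRange {B L G D : Type*} (lim : OperationalLimits B L G)
    (N : PowerNetwork B L G D) (l : L) : Set (ℝ × ℝ × ℝ) :=
  Set.Icc (lim.vMin (N.fromBus l)) (lim.vMax (N.fromBus l)) ×ˢ
    (Set.Icc (lim.vMin (N.toBus l)) (lim.vMax (N.toBus l)) ×ˢ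
      Set.Icc (lim.phiMin l) (lim.phiMax l))

/-- Lower and upper bounding functions for the residuals: of `p_g,ref,i` for `g^p`, of
`(v_l^f, v_l^t, φ_l)` for `g^cos` and `g^sin`, and of `v_k` for `g^v`. -/
structure BoundingFunctions (B L G : Type*) where
  pL : G → ℝ → ℝ
  pU : G → ℝ → ℝ
  cosL : L → ℝ × ℝ × ℝ → ℝ
  cosU : L → ℝ × ℝ × ℝ → ℝ
  sinL : L → ℝ × ℝ × ℝ → ℝ
  sinU : L → ℝ × ℝ × ℝ → ℝ
  vL : B → ℝ → ℝ
  vU : B → ℝ → ℝ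

namespace PowerNetwork

variable {B L G D : Type*} [Fintype B] [Fintype L] [Fintype G] [Fintype D]
  [DecidableEq B] (N : PowerNetwork B L G D)

/-- `f(x, u, w) = M ψ(x, u) + R w`. -/
noncomputable def f (x : N.XIdx → ℝ) (u : N.Dispatch) (w : D ⊕ D → ℝ) : N.FIdx → ℝ :=
  N.M.mulVec (N.psi x u) + N.R.mulVec w

/-- The power flow Jacobian `J_f,(0)`; as `f` is affine in `w`, it does not depend on `w`, which is
put to `0`. -/
noncomputable def Jf (x0 : N.XIdx → ℝ) (u0 : N.Dispatch) : Matrix N.FIdx N.XIdx ℝ :=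
  jacobian (fun x => N.f x u0 0) x0

/-- The Jacobian `J_ψ,(0)` of the basis functions. -/
noncomputable def Jpsi (x0 : N.XIdx → ℝ) (u0 : N.Dispatch) : Matrix N.PsiIdx N.XIdx ℝ :=
  jacobian (fun x => N.psi x u0) x0

/-- The residual `g(x, u) = ψ(x, u) - J_ψ,(0) x`. -/
noncomputable def residual (x0 : N.XIdx → ℝ) (u0 : N.Dispatch) (x : N.XIdx → ℝ) (u : N.Dispatch) :
    N.PsiIdx → ℝ :=
  N.psi x u - (N.Jpsi x0 u0).mulVec x

/-- The outer approximation `P(z^u, z^ℓ)`. -/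
def polytope (zu zl : N.ZIdx → ℝ) : Set (N.XIdx → ℝ) :=
  {x | zl ≤ N.A.mulVec x ∧ N.A.mulVec x ≤ zu}

/-- The bound on the voltage at each bus that is given by a bound `z` on the transformed state; at
PV buses it is the set point. -/
noncomputable def voltBound (u : N.Dispatch) (z : N.ZIdx → ℝ) : B → ℝ :=
  N.withSetpoints u fun k => z (Sum.inr (Sum.inl k))

/-- `K = -A J_f,(0)⁻¹ M`. -/
noncomputable def K (x0 : N.XIdx → ℝ) (u0 : N.Dispatch) : Matrix N.ZIdx N.PsiIdx ℝ :=
  -(N.A * matInv (N.Jf x0 u0) * N.M)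

/-- `ξ^u(γ)`, where `S` stands for `Σ^{1/2}`. -/
noncomputable def xiU (x0 : N.XIdx → ℝ) (u0 : N.Dispatch) (w0 : D ⊕ D → ℝ)
    (S : Matrix (D ⊕ D) (D ⊕ D) ℝ) (γ : ℝ) (i : N.ZIdx) : ℝ :=
  -(N.A * matInv (N.Jf x0 u0) * N.R).mulVec w0 i
    + γ * ‖WithLp.toLp 2 ((N.A * matInv (N.Jf x0 u0) * N.R * S) i)‖

/-- `ξ^ℓ(γ)`, where `S` stands for `Σ^{1/2}`. -/
noncomputable def xiL (x0 : N.XIdx → ℝ) (u0 : N.Dispatch) (w0 : D ⊕ D → ℝ)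
    (S : Matrix (D ⊕ D) (D ⊕ D) ℝ) (γ : ℝ) (i : N.ZIdx) : ℝ :=
  -(N.A * matInv (N.Jf x0 u0) * N.R).mulVec w0 i
    - γ * ‖WithLp.toLp 2 ((N.A * matInv (N.Jf x0 u0) * N.R * S) i)‖

/-- The bounding functions are upper convex and lower concave envelopes of the residual: the upper
ones are convex, the lower ones concave, and they enclose the residual at all `x`, `u` at which the
quantities they depend on are within the operational limits. -/
structure IsEnvelope (x0 : N.XIdx → ℝ) (u0 : N.Dispatch) (lim : OperationalLimits B L G)
    (e : BoundingFunctions B L G) : Prop where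
  concave_p : ∀ i, ConcaveOn ℝ (Set.Icc (lim.pMin i) (lim.pMax i)) (e.pL i)
  convex_p : ∀ i, ConvexOn ℝ (Set.Icc (lim.pMin i) (lim.pMax i)) (e.pU i)
  concave_cos : ∀ l, ConcaveOn ℝ (lim.lineRange N l) (e.cosL l)
  convex_cos : ∀ l, ConvexOn ℝ (lim.lineRange N l) (e.cosU l)
  concave_sin : ∀ l, ConcaveOn ℝ (lim.lineRange N l) (e.sinL l)
  convex_sin : ∀ l, ConvexOn ℝ (lim.lineRange N l) (e.sinU l)
  concave_v : ∀ k, ConcaveOn ℝ (Set.Icc (lim.vMin k) (lim.vMax k)) (e.vL k)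
  convex_v : ∀ k, ConvexOn ℝ (Set.Icc (lim.vMin k) (lim.vMax k)) (e.vU k)
  encloses_p : ∀ x u i, u.pRef i ∈ Set.Icc (lim.pMin i) (lim.pMax i) →
    N.residual x0 u0 x u (Sum.inl i) ∈ Set.Icc (e.pL i (u.pRef i)) (e.pU i (u.pRef i))
  encloses_cos : ∀ x u l,
    (N.volt x u (N.fromBus l), N.volt x u (N.toBus l), N.phi x l) ∈ lim.lineRange N l →
    N.residual x0 u0 x u (Sum.inr (Sum.inl l)) ∈
      Set.Icc (e.cosL l (N.volt x u (N.fromBus l), N.volt x u (N.toBus l), N.phi x l))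
        (e.cosU l (N.volt x u (N.fromBus l), N.volt x u (N.toBus l), N.phi x l))
  encloses_sin : ∀ x u l,
    (N.volt x u (N.fromBus l), N.volt x u (N.toBus l), N.phi x l) ∈ lim.lineRange N l →
    N.residual x0 u0 x u (Sum.inr (Sum.inr (Sum.inl l))) ∈
      Set.Icc (e.sinL l (N.volt x u (N.fromBus l), N.volt x u (N.toBus l), N.phi x l))
        (e.sinU l (N.volt x u (N.fromBus l), N.volt x u (N.toBus l), N.phi x l))
  encloses_v : ∀ x u k, N.volt x u k ∈ Set.Icc (lim.vMin k) (lim.vMax k) →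
    N.residual x0 u0 x u (Sum.inr (Sum.inr (Sum.inr k))) ∈
      Set.Icc (e.vL k (N.volt x u k)) (e.vU k (N.volt x u k))

/-- The vertex inequalities for the residual bounds `g^u_P = gu` and `g^ℓ_P = gl`. -/
structure VertexInequalities (e : BoundingFunctions B L G) (u : N.Dispatch)
    (zu zl : N.ZIdx → ℝ) (gu gl : N.PsiIdx → ℝ) : Prop where
  p : ∀ i, gl (Sum.inl i) ≤ e.pL i (u.pRef i) ∧ e.pU i (u.pRef i) ≤ gu (Sum.inl i)
  cos : ∀ l,
    ∀ vf ∈ ({N.voltBound u zl (N.fromBus l), N.voltBound u zu (N.fromBus l)} : Set ℝ),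
    ∀ vt ∈ ({N.voltBound u zl (N.toBus l), N.voltBound u zu (N.toBus l)} : Set ℝ),
    ∀ φ ∈ ({zl (Sum.inl l), zu (Sum.inl l)} : Set ℝ),
      gl (Sum.inr (Sum.inl l)) ≤ e.cosL l (vf, vt, φ) ∧
      e.cosU l (vf, vt, φ) ≤ gu (Sum.inr (Sum.inl l))
  sin : ∀ l,
    ∀ vf ∈ ({N.voltBound u zl (N.fromBus l), N.voltBound u zu (N.fromBus l)} : Set ℝ),
    ∀ vt ∈ ({N.voltBound u zl (N.toBus l), N.voltBound u zu (N.toBus l)} : Set ℝ),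
    ∀ φ ∈ ({zl (Sum.inl l), zu (Sum.inl l)} : Set ℝ),
      gl (Sum.inr (Sum.inr (Sum.inl l))) ≤ e.sinL l (vf, vt, φ) ∧
      e.sinU l (vf, vt, φ) ≤ gu (Sum.inr (Sum.inr (Sum.inl l)))
  v : ∀ k, ∀ vk ∈ ({N.voltBound u zl k, N.voltBound u zu k} : Set ℝ),
    gl (Sum.inr (Sum.inr (Sum.inr k))) ≤ e.vL k vk ∧
    e.vU k vk ≤ gu (Sum.inr (Sum.inr (Sum.inr k)))

/-- The dispatch point and the state bounds are within the operational limits. -/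
structure WithinLimits (lim : OperationalLimits B L G) (u : N.Dispatch)
    (zu zl : N.ZIdx → ℝ) : Prop where
  p : ∀ i, u.pRef i ∈ Set.Icc (lim.pMin i) (lim.pMax i)
  v_lower : ∀ k, N.voltBound u zl k ∈ Set.Icc (lim.vMin k) (lim.vMax k)
  v_upper : ∀ k, N.voltBound u zu k ∈ Set.Icc (lim.vMin k) (lim.vMax k)
  phi_lower : ∀ l, zl (Sum.inl l) ∈ Set.Icc (lim.phiMin l) (lim.phiMax l)
  phi_upper : ∀ l, zu (Sum.inl l) ∈ Set.Icc (lim.phiMin l) (lim.phiMax l)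

end PowerNetwork

/-! Since `f` is `M ψ + R w` and `J = M J_ψ`, substituting `ψ = g + J_ψ x` turns `f = 0` into the
fixed point equation `x = -J⁻¹ (M g(x, u) + R w)`. Applying `A` to the right side gives `K g - A J⁻¹
R w`. For `x` in the polytope, voltages and angle differences lie in a box. A convex upper (concave
lower) envelope is extremal at vertices of that box, so `g` lies between `gl` and `gu`
(`VertexInequalities.residual_mem_Icc`). Splitting `K` by sign bounds `K g`
(`mulVec_le_of_mem_Icc`), and Cauchy–Schwarz bounds the term in `w`
(`abs_dotProduct_sub_le_of_mem_confidenceEllipsoid`). The two hypotheses on `zu` and `zl` then say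
that the polytope is mapped into itself. The polytope is compact because nonsingularity of `J`
forces `A` to be injective (`A_mulVec_injective`), and nonempty because `gl ≤ gu`
(`VertexInequalities.lower_le_upper`). Brouwer's theorem, proved here by the Milnor–Rogers volume
argument, gives a zero of `f`. Reactive balance at PV buses, absent from `f`, is met by choosing
`q_g`. -/

/-! ### Brouwer's fixed point theorem -/

section Brouwer

open MeasureTheory Metric

/-- Values at `1` of polynomials of bounded degree are a fixed linear combination of values at
finitely many points close to `0`. -/
lemma Polynomial.exists_eval_one_eq_sum (n : ℕ) {τ : ℝ} (hτ : 0 < τ) :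
    ∃ t c : ℕ → ℝ, (∀ i, 0 < t i ∧ t i ≤ τ) ∧ ∀ p : Polynomial ℝ, p.natDegree ≤ n →
      p.eval 1 = ∑ i ∈ Finset.range (n + 1), c i * p.eval (t i) := by
  have hinj : Function.Injective fun i : ℕ => τ / (i + 1) := by
    intro i j h
    have hi : (0 : ℝ) < i + 1 := by positivity
    have hj : (0 : ℝ) < j + 1 := by positivity
    simp only at h
    rw [div_eq_div_iff hi.ne' hj.ne'] at h
    have := mul_left_cancel₀ hτ.ne' h
    exact_mod_cast (add_right_cancel this).symm
  refine ⟨fun i => τ / (i + 1),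
    fun i => (Lagrange.basis (Finset.range (n + 1)) (fun i : ℕ => τ / (i + 1)) i).eval 1,
    fun i => ⟨by positivity, div_le_self hτ.le (by norm_cast; omega)⟩, fun p hp => ?_⟩
  have hdeg : p.degree < (Finset.range (n + 1)).card := by
    rw [Finset.card_range]
    exact (Polynomial.degree_le_natDegree).trans_lt (by exact_mod_cast Nat.lt_succ_of_le hp)
  conv_lhs => rw [Lagrange.eq_interpolate (hinj.injOn) hdeg]
  simp [Lagrange.interpolate_apply, Polynomial.eval_finsetSum, mul_comm]

variable {E : Type*} [NormedAddCommGroup E]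

/-- The degree bound depends only on the dimension, so one set of interpolation nodes serves the
derivatives at all points of the ball. -/
lemma ContinuousLinearMap.exists_polynomial_eval_eq_det [NormedSpace ℝ E] [FiniteDimensional ℝ E]
    (A : E →L[ℝ] E) :
    ∃ p : Polynomial ℝ, p.natDegree ≤ Module.finrank ℝ E ∧
      ∀ t : ℝ, p.eval t = (ContinuousLinearMap.id ℝ E + t • A).det := by
  let b := Module.finBasis ℝ E
  let Q := LinearMap.toMatrix b b (A : E →ₗ[ℝ] E)
  refine ⟨Matrix.det ((Polynomial.X : Polynomial ℝ) • Q.map Polynomial.C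
    + (1 : Matrix _ _ ℝ).map Polynomial.C), ?_, fun t => ?_⟩
  · simpa using Polynomial.natDegree_det_X_add_C_le Q 1
  · rw [← Polynomial.coe_evalRingHom, RingHom.map_det, ContinuousLinearMap.det,
      ← LinearMap.det_toMatrix b]
    congr 1
    ext i j
    simp [Q, LinearMap.toMatrix_apply, Matrix.one_apply, Finsupp.single_apply, eq_comm, add_comm,
      apply_ite]
    exact mul_comm _ _

/-- There is no `C¹` retraction of a closed ball onto its boundary sphere. -/
theorem not_exists_contDiff_retraction [InnerProductSpace ℝ E] [FiniteDimensional ℝ E]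
    {R : ℝ} (hR : 0 < R) {U : Set E} (hU : IsOpen U) (hBU : closedBall (0 : E) R ⊆ U) {r : E → E}
    (hr : ContDiffOn ℝ 1 r U) (hsphere : ∀ x ∈ closedBall (0 : E) R, ‖r x‖ = R)
    (hfix : ∀ x ∈ sphere (0 : E) R, r x = x) : False := by
  borelize E
  have hdiff : ∀ x ∈ closedBall (0 : E) R, HasFDerivAt r (fderiv ℝ r x) x := fun x hx =>
    ((hr.differentiableOn one_ne_zero).differentiableAt (hU.mem_nhds (hBU hx))).hasFDerivAt
  have hcont : ContinuousOn (fderiv ℝ r) (closedBall 0 R) :=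
    (hr.continuousOn_fderiv_of_isOpen hU le_rfl).mono hBU
  -- `A` is the derivative of the displacement `r - id`; the homotopy `x + t (r x - x)` has
  -- derivative `id + t A`.
  set A : E → E →L[ℝ] E := fun x => fderiv ℝ r x - ContinuousLinearMap.id ℝ E with hA
  have hAcont : ContinuousOn A (closedBall 0 R) := hcont.sub continuousOn_const
  obtain ⟨C, hC⟩ := (isCompact_closedBall (0 : E) R).exists_bound_of_continuousOn hAcont
  have hC0 : 0 ≤ C := (norm_nonneg _).trans (hC 0 (by simp [hR.le]))
  have hlip : ∀ x ∈ closedBall (0 : E) R, ∀ y ∈ closedBall (0 : E) R,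
      ‖(r x - x) - (r y - y)‖ ≤ C * ‖x - y‖ := fun x hx y hy =>
    (convex_closedBall (0 : E) R).norm_image_sub_le_of_norm_hasFDerivWithin_le
      (f := fun x => r x - x) (f' := A)
      (fun z hz => ((hdiff z hz).sub (hasFDerivAt_id z)).hasFDerivWithinAt) hC hy hx
  obtain ⟨ε, hε, hdet⟩ : ∃ ε > 0, ∀ T : E →L[ℝ] E, ‖T‖ < ε →
      0 < (ContinuousLinearMap.id ℝ E + T).det := by
    have hc : Continuous fun T : E →L[ℝ] E => (ContinuousLinearMap.id ℝ E + T).det :=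
      ContinuousLinearMap.continuous_det.comp (continuous_const.add continuous_id)
    have h0 : (0 : ℝ) < (ContinuousLinearMap.id ℝ E + 0).det := by
      simp [ContinuousLinearMap.det]
    obtain ⟨ε, hε, h⟩ := Metric.eventually_nhds_iff.1 (hc.continuousAt.eventually (lt_mem_nhds h0))
    exact ⟨ε, hε, fun T hT => h (by simpa using hT)⟩
  -- For `t ≤ τ`: `τ ≤ 1` keeps the homotopy inside the ball, `τ C < 1` makes it a small Lipschitz
  -- perturbation of the identity, hence injective and open, and `τ C < ε` makes its Jacobian
  -- determinant positive.
  obtain ⟨τ, hτ, hτ1, hτC, hτε⟩ : ∃ τ > 0, τ ≤ 1 ∧ τ * C < 1 ∧ τ * C < ε := by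
    refine ⟨min 1 (min 1 ε / (C + 1)), by positivity, min_le_left _ _, ?_⟩
    have h1 : min 1 (min 1 ε / (C + 1)) * C < min 1 ε := by
      calc min 1 (min 1 ε / (C + 1)) * C ≤ min 1 ε / (C + 1) * C := by
            gcongr; exact min_le_right _ _
        _ < min 1 ε := by
          rw [div_mul_eq_mul_div, div_lt_iff₀ (by positivity)]
          have : 0 < min 1 ε := by positivity
          nlinarith
    exact ⟨h1.trans_le (min_le_left _ _), h1.trans_le (min_le_right _ _)⟩
  have hvol : ∀ t, 0 < t → t ≤ τ →
      ∫ x in ball (0 : E) R, (ContinuousLinearMap.id ℝ E + t • A x).det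
        = volume.real (ball (0 : E) R) := by
    intro t ht htτ
    set h : E → E := fun x => x + t • (r x - x) with hh
    have htC : t * C < 1 := (mul_le_mul_of_nonneg_right htτ hC0).trans_lt hτC
    have hball : ∀ x ∈ closedBall (0 : E) R, h x ∈ closedBall (0 : E) R := by
      intro x hx
      have := (convex_closedBall (0 : E) R).add_smul_sub_mem hx
        (show r x ∈ closedBall (0 : E) R by simp [hsphere x hx]) ⟨ht.le, htτ.trans hτ1⟩
      simpa [hh] using this
    have happrox : ApproximatesLinearOn h (ContinuousLinearEquiv.refl ℝ E : E →L[ℝ] E)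
        (closedBall 0 R) (t * C).toNNReal := by
      intro x hx y hy
      have := hlip x hx y hy
      calc ‖h x - h y - (ContinuousLinearEquiv.refl ℝ E : E →L[ℝ] E) (x - y)‖
          = ‖t • ((r x - x) - (r y - y))‖ := by
            congr 1
            simp only [hh, ContinuousLinearEquiv.coe_refl, ContinuousLinearMap.coe_id', id]
            rw [smul_sub t (r x - x)]; abel
        _ = t * ‖(r x - x) - (r y - y)‖ := by rw [norm_smul, Real.norm_of_nonneg ht.le]
        _ ≤ t * (C * ‖x - y‖) := by gcongr
        _ = _ := by rw [Real.coe_toNNReal _ (by positivity), mul_assoc]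
    have hderiv : ∀ x ∈ ball (0 : E) R,
        HasFDerivWithinAt h (ContinuousLinearMap.id ℝ E + t • A x) (ball 0 R) x := fun x hx =>
      ((hasFDerivAt_id x).add (((hdiff x (ball_subset_closedBall hx)).sub
        (hasFDerivAt_id x)).const_smul t)).hasFDerivWithinAt
    have hpos : ∀ x ∈ ball (0 : E) R, 0 < (ContinuousLinearMap.id ℝ E + t • A x).det := by
      intro x hx
      refine hdet _ ?_
      rw [norm_smul, Real.norm_of_nonneg ht.le]
      exact (mul_le_mul htτ (hC x (ball_subset_closedBall hx)) (norm_nonneg _) hτ.le).trans_lt hτε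
    have hc : Subsingleton E ∨ (t * C).toNNReal <
        ‖((ContinuousLinearEquiv.refl ℝ E).symm : E →L[ℝ] E)‖₊⁻¹ := by
      rcases subsingleton_or_nontrivial E with hE | hE
      · exact Or.inl hE
      · right
        simpa using htC
    have hinj : Set.InjOn h (ball 0 R) := (happrox.injOn hc).mono ball_subset_closedBall
    have hopen : IsOpen (h '' ball 0 R) :=
      ((happrox.mono_set ball_subset_closedBall).toOpenPartialHomeomorph _ _ hc
        isOpen_ball).open_target
    have hcompact : IsCompact (h '' closedBall 0 R) :=
      (isCompact_closedBall (0 : E) R).image_of_continuousOn happrox.continuousOn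
    -- The sphere is fixed pointwise, so within the open ball the images of the open and of the
    -- closed ball coincide. This set is relatively open and closed, and the ball is connected.
    have himage : h '' ball 0 R = ball 0 R := by
      have hsub : h '' ball 0 R ⊆ ball 0 R := by
        refine (interior_closedBall (0 : E) hR.ne').subset.trans' (hopen.subset_interior_iff.2 ?_)
        rintro _ ⟨x, hx, rfl⟩
        exact hball x (ball_subset_closedBall hx)
      apply Set.Subset.antisymm hsub
      · refine (convex_ball (0 : E) R).isPreconnected.subset_left_of_subset_union hopen
          hcompact.isClosed.isOpen_compl
          (disjoint_compl_right.mono_left (Set.image_mono ball_subset_closedBall)) ?_ ?_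
        · intro y hy
          by_cases hyc : y ∈ h '' closedBall 0 R
          · obtain ⟨x, hx, rfl⟩ := hyc
            refine Or.inl ⟨x, ?_, rfl⟩
            by_contra hxb
            have hxs : x ∈ sphere (0 : E) R := by
              simp only [mem_closedBall, mem_ball, mem_sphere] at *
              exact le_antisymm hx (not_lt.1 hxb)
            have hhx : h x = x := by simp [hh, hfix x hxs]
            exact hxb (hhx ▸ hy)
          · exact Or.inr hyc
        · exact ⟨h 0, hsub ⟨0, mem_ball_self hR, rfl⟩, 0, mem_ball_self hR, rfl⟩
    have := integral_image_eq_integral_abs_det_fderiv_smul volume measurableSet_ball hderiv hinj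
      (fun _ => (1 : ℝ))
    rw [himage, setIntegral_const] at this
    simp only [smul_eq_mul, mul_one] at this
    rw [this]
    exact setIntegral_congr_fun measurableSet_ball fun x hx => (abs_of_pos (hpos x hx)).symm
  -- Differentiating the constant `‖r‖²` shows that the range of the derivative is orthogonal to `r
  -- x ≠ 0`, so the derivative is not surjective.
  have hdet0 : ∀ x ∈ ball (0 : E) R, (ContinuousLinearMap.id ℝ E + (1 : ℝ) • A x).det = 0 := by
    intro x hx
    have horth : ∀ v, inner ℝ (r x) (fderiv ℝ r x v) = 0 := by
      intro v
      have h1 := (hdiff x (ball_subset_closedBall hx)).norm_sq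
      have h2 : HasFDerivAt (fun y => ‖r y‖ ^ 2) (0 : E →L[ℝ] ℝ) x := by
        refine (hasFDerivAt_const (R ^ 2) x).congr_of_eventuallyEq ?_
        filter_upwards [isOpen_ball.mem_nhds hx] with y hy
        rw [hsphere y (ball_subset_closedBall hy)]
      have := DFunLike.congr_fun (h1.unique h2) v
      simpa using this
    by_contra hne
    have hsurj : Function.Surjective (fderiv ℝ r x) := by
      have : (ContinuousLinearMap.id ℝ E + (1 : ℝ) • A x) = fderiv ℝ r x := by simp [hA]
      rw [this] at hne
      exact (LinearMap.equivOfDetNeZero _ hne).surjective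
    obtain ⟨v, hv⟩ := hsurj (r x)
    have := horth v
    rw [hv, real_inner_self_eq_norm_sq, hsphere x (ball_subset_closedBall hx)] at this
    exact hR.ne' (by simpa using this)
  obtain ⟨t, c, ht, hsum⟩ := Polynomial.exists_eval_one_eq_sum (Module.finrank ℝ E) hτ
  have hint : ∀ s : ℝ, IntegrableOn (fun x => (ContinuousLinearMap.id ℝ E + s • A x).det)
      (ball (0 : E) R) := fun s =>
    ((ContinuousLinearMap.continuous_det.comp_continuousOn
      (continuousOn_const.add (hAcont.const_smul s))).integrableOn_compact
      (isCompact_closedBall 0 R)).mono_set ball_subset_closedBall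
  have h0 : ∫ x in ball (0 : E) R, (ContinuousLinearMap.id ℝ E + (1 : ℝ) • A x).det = 0 := by
    rw [setIntegral_congr_fun measurableSet_ball hdet0]
    simp
  have h1 : ∫ x in ball (0 : E) R, (ContinuousLinearMap.id ℝ E + (1 : ℝ) • A x).det
      = volume.real (ball (0 : E) R) := by
    -- The weights `c` do not depend on `x`, so interpolation commutes with the integral and carries
    -- the volume from small times to time `1`.
    have hpt : ∀ x, (ContinuousLinearMap.id ℝ E + (1 : ℝ) • A x).det =
        ∑ i ∈ Finset.range (Module.finrank ℝ E + 1),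
          c i * (ContinuousLinearMap.id ℝ E + t i • A x).det := by
      intro x
      obtain ⟨p, hp, hpe⟩ := (A x).exists_polynomial_eval_eq_det
      simp only [← hpe]
      exact hsum p hp
    have hc1 : ∑ i ∈ Finset.range (Module.finrank ℝ E + 1), c i = 1 := by
      simpa using (hsum 1 (by simp)).symm
    simp_rw [hpt]
    rw [integral_finsetSum _ fun i _ => (hint (t i)).const_mul (c i)]
    simp_rw [integral_const_mul, hvol _ (ht _).1 (ht _).2]
    rw [← Finset.sum_mul, hc1, one_mul]
  have hposvol : 0 < volume.real (ball (0 : E) R) :=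
    ENNReal.toReal_pos (measure_ball_pos volume _ hR).ne' measure_ball_lt_top.ne
  exact hposvol.ne' (h1.symm.trans h0)

/-- Without a fixed point, a `C¹` approximation `H` of `F` has none on a large ball either; pushing
`x` along the ray from `H x` through `x` to the sphere would be a `C¹` retraction. -/
lemma exists_fixedPoint_of_continuous_of_norm_le [InnerProductSpace ℝ E] [FiniteDimensional ℝ E]
    {F : E → E} (hF : Continuous F) {ρ : ℝ} (hρ : ∀ x, ‖F x‖ ≤ ρ) : ∃ x, F x = x := by
  by_contra! hne
  have hρ0 : 0 ≤ ρ := (norm_nonneg _).trans (hρ 0)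
  obtain ⟨R, hR⟩ : ∃ R, R = ρ + 1 := ⟨_, rfl⟩
  have hR0 : 0 < R := by linarith
  obtain ⟨x₀, -, hmin⟩ := (isCompact_closedBall (0 : E) R).exists_isMinOn
    ⟨0, by simp [hR0.le]⟩ (hF.sub continuous_id).norm.continuousOn
  -- An error below the least displacement on the ball keeps `H` free of fixed points there; an
  -- error below `1` keeps its values inside radius `R = ρ + 1`.
  have hδ : 0 < min ‖F x₀ - x₀‖ 1 := lt_min (norm_pos_iff.2 (sub_ne_zero.2 (hne x₀))) one_pos
  obtain ⟨H, hH, happ, -⟩ := hF.exists_contDiff_approx 1 continuous_const fun _ : E => hδ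
  have hHR : ∀ x, ‖H x‖ < R := by
    intro x
    have h1 := (happ x).trans_le (min_le_right _ _)
    rw [dist_eq_norm] at h1
    have := norm_le_norm_add_norm_sub' (H x) (F x)
    linarith [hρ x]
  have hHne : ∀ x ∈ closedBall (0 : E) R, x - H x ≠ 0 := by
    intro x hx h0
    have h1 := (happ x).trans_le (min_le_left _ _)
    rw [← sub_eq_zero.1 h0, dist_comm, dist_eq_norm] at h1
    exact h1.not_ge (hmin hx)
  -- `q` is a quarter of the discriminant of `‖x + s (x - H x)‖² = R²` as a quadratic in `s`; `r`
  -- uses the larger root.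
  set q : E → ℝ := fun x =>
    inner ℝ x (x - H x) ^ 2 + ‖x - H x‖ ^ 2 * (R ^ 2 - ‖x‖ ^ 2) with hq
  set r : E → E := fun x =>
    x + ((-inner ℝ x (x - H x) + √(q x)) / ‖x - H x‖ ^ 2) • (x - H x) with hr
  have hd : ContDiff ℝ 1 fun x => x - H x := contDiff_id.sub hH
  have hqd : ContDiff ℝ 1 q :=
    ((contDiff_id.inner ℝ hd).pow 2).add ((hd.norm_sq ℝ).mul
      (contDiff_const.sub (contDiff_id.norm_sq ℝ)))
  -- On the sphere this positivity keeps the square root smooth and makes the larger root `0`, so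
  -- that `r` fixes the sphere.
  have hb : ∀ x ∈ sphere (0 : E) R, 0 < inner ℝ x (x - H x) := by
    intro x hx
    rw [mem_sphere_zero_iff_norm] at hx
    rw [inner_sub_right, real_inner_self_eq_norm_sq, hx]
    have := real_inner_le_norm x (H x)
    rw [hx] at this
    nlinarith [hHR x]
  have hqpos : ∀ x ∈ closedBall (0 : E) R, 0 < q x := by
    intro x hx
    rcases (mem_closedBall_zero_iff.1 hx).lt_or_eq with h | h
    · have h1 : 0 < ‖x - H x‖ := norm_pos_iff.2 (hHne x hx)
      have h2 : 0 < R ^ 2 - ‖x‖ ^ 2 := by nlinarith [norm_nonneg x]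
      simp only [hq]
      positivity
    · have := hb x (by simpa using h)
      simp only [hq, h, sub_self, mul_zero, add_zero]
      positivity
  refine not_exists_contDiff_retraction hR0 (U := {x | x - H x ≠ 0 ∧ 0 < q x}) (r := r) ?_
    (fun x hx => ⟨hHne x hx, hqpos x hx⟩) ?_ ?_ ?_
  · exact (isOpen_ne_fun hd.continuous continuous_const).inter
      (isOpen_lt continuous_const hqd.continuous)
  · intro x hx
    have hsqrt : ContDiffAt ℝ 1 (fun y => √(q y)) x := hqd.contDiffAt.sqrt hx.2.ne'
    have : ContDiffAt ℝ 1 r x := contDiffAt_id.add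
      (((((contDiff_id.inner ℝ hd).neg.contDiffAt).add hsqrt).div (hd.norm_sq ℝ).contDiffAt
        (by simpa using hx.1)).smul hd.contDiffAt)
    exact this.contDiffWithinAt
  · intro x hx
    have ha : ‖x - H x‖ ≠ 0 := norm_ne_zero_iff.2 (hHne x hx)
    have hs : √(q x) ^ 2 = q x := Real.sq_sqrt (hqpos x hx).le
    have : ‖r x‖ ^ 2 = R ^ 2 := by
      simp only [hr]
      rw [norm_add_sq_real, inner_smul_right, norm_smul, mul_pow, Real.norm_eq_abs, sq_abs]
      generalize √(q x) = s at hs ⊢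
      simp only [hq] at hs
      field_simp
      linear_combination hs
    exact (sq_eq_sq₀ (norm_nonneg _) hR0.le).1 this
  · intro x hx
    have hx' : ‖x‖ = R := by simpa using hx
    simp only [hr, hq, hx', sub_self, mul_zero, add_zero, Real.sqrt_sq (hb x hx).le]
    simp

/-- A complete convex set in a real inner product space is a retract of the space. -/
lemma exists_continuous_retraction_of_convex [InnerProductSpace ℝ E] {s : Set E}
    (hne : s.Nonempty) (hs : IsComplete s) (hconv : Convex ℝ s) :
    ∃ p : E → E, Continuous p ∧ (∀ x, p x ∈ s) ∧ ∀ x ∈ s, p x = x := by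
  choose p hps hp using exists_norm_eq_iInf_of_complete_convex hne hs hconv
  have hvar : ∀ x, ∀ y ∈ s, inner ℝ (x - p x) (y - p x) ≤ 0 := fun x =>
    (norm_eq_iInf_iff_real_inner_le_zero hconv (hps x)).1 (hp x)
  refine ⟨p, ?_, hps, fun x hx => ?_⟩
  · refine (LipschitzWith.of_dist_le_mul (K := 1) fun x y => ?_).continuous
    rw [NNReal.coe_one, one_mul, dist_eq_norm, dist_eq_norm]
    have h1 := hvar x (p y) (hps y)
    have h2 := hvar y (p x) (hps x)
    -- Adding the variational inequalities of the two nearest points shows that the projection is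
    -- nonexpansive.
    have h3 : ‖p x - p y‖ ^ 2 ≤ inner ℝ (x - y) (p x - p y) := by
      rw [← real_inner_self_eq_norm_sq]
      simp only [inner_sub_left, inner_sub_right] at *
      linarith
    have h4 := h3.trans (real_inner_le_norm _ _)
    by_contra! h
    nlinarith [norm_nonneg (x - y)]
  · have := hvar x x hx
    rw [real_inner_self_eq_norm_sq] at this
    have h0 : ‖x - p x‖ = 0 := by nlinarith [norm_nonneg (x - p x)]
    exact (sub_eq_zero.1 (norm_eq_zero.1 h0)).symm

/-- The **Brouwer fixed point theorem** for compact convex sets. -/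
theorem IsCompact.exists_fixedPoint_of_convex [NormedSpace ℝ E] [FiniteDimensional ℝ E]
    {s : Set E} (hs : IsCompact s) (hconv : Convex ℝ s) (hne : s.Nonempty) {F : E → E}
    (hF : ContinuousOn F s) (hmaps : Set.MapsTo F s s) : ∃ x ∈ s, F x = x := by
  -- The norm of `E` need not come from an inner product, so the problem is moved to Euclidean
  -- space. Precomposing with the retraction extends the map to the whole space; its fixed point
  -- lies in `e '' s`, where the retraction is the identity.
  let e : E ≃L[ℝ] EuclideanSpace ℝ (Fin (Module.finrank ℝ E)) := toEuclidean
  have hs' : IsCompact (e '' s) := hs.image e.continuous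
  obtain ⟨p, hpc, hps, hpe⟩ := exists_continuous_retraction_of_convex (hne.image e)
    hs'.isComplete (hconv.linear_image e.toLinearEquiv.toLinearMap)
  have hsymm : ∀ y, e.symm (p y) ∈ s := by
    intro y
    obtain ⟨x, hx, hxy⟩ := hps y
    rw [← hxy, e.symm_apply_apply]
    exact hx
  obtain ⟨ρ, hρ⟩ := hs'.exists_bound_of_continuousOn continuousOn_id
  obtain ⟨y, hy⟩ := exists_fixedPoint_of_continuous_of_norm_le
    (F := fun y => e (F (e.symm (p y))))
    (e.continuous.comp (hF.comp_continuous (e.symm.continuous.comp hpc) hsymm))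
    (fun y => hρ _ ⟨_, hmaps (hsymm y), rfl⟩)
  have hys : y ∈ e '' s := hy ▸ ⟨_, hmaps (hsymm y), rfl⟩
  refine ⟨e.symm y, by simpa [hpe y hys] using hsymm y, ?_⟩
  simp only [hpe y hys] at hy
  rw [e.eq_symm_apply, hy]

end Brouwer

/-! ### Interval bounds and the confidence ellipsoid -/

section MatrixBounds

variable {m n : Type*} [Fintype n]

/-- `K = K⁺ + K⁻`, where `K⁺` preserves and `K⁻` reverses inequalities. -/
lemma mulVec_le_of_mem_Icc (K : Matrix m n ℝ) {gl g gu : n → ℝ} (h : g ∈ Set.Icc gl gu) :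
    K.mulVec g ≤ (posPartMat K).mulVec gu + (negPartMat K).mulVec gl := by
  intro i
  simp only [Pi.add_apply, Matrix.mulVec, dotProduct, posPartMat, negPartMat, Matrix.map_apply]
  rw [← Finset.sum_add_distrib]
  refine Finset.sum_le_sum fun j _ => ?_
  have h1 := mul_le_mul_of_nonneg_left (h.2 j) (le_max_right (K i j) 0)
  have h2 := mul_le_mul_of_nonpos_left (h.1 j) (min_le_right (K i j) 0)
  calc K i j * g j = (max (K i j) 0 + min (K i j) 0) * g j := by rw [max_add_min, add_zero]
    _ ≤ _ := by rw [add_mul]; exact add_le_add h1 h2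

lemma le_mulVec_of_mem_Icc (K : Matrix m n ℝ) {gl g gu : n → ℝ} (h : g ∈ Set.Icc gl gu) :
    (posPartMat K).mulVec gl + (negPartMat K).mulVec gu ≤ K.mulVec g := by
  have := mulVec_le_of_mem_Icc K (gl := -gu) (g := -g) (gu := -gl)
    ⟨neg_le_neg h.2, neg_le_neg h.1⟩
  simp only [Matrix.mulVec_neg, ← neg_add] at this
  exact neg_le_neg_iff.1 this

/-- With `w - w0 = S y` the ellipsoid becomes the ball `‖y‖ ≤ γ`, and Cauchy–Schwarz applies to `(a
S) · y`. -/
lemma abs_dotProduct_sub_le_of_mem_confidenceEllipsoid [DecidableEq n] {Sig S : Matrix n n ℝ}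
    (hSig : Sig.PosDef) (hS : S * S.transpose = Sig) {w0 w : n → ℝ} {γ : ℝ} (hγ : 0 ≤ γ)
    (hw : w ∈ confidenceEllipsoid Sig w0 γ) (a : n → ℝ) :
    |a ⬝ᵥ (w - w0)| ≤ γ * ‖WithLp.toLp 2 (Matrix.vecMul a S)‖ := by
  have hdet : IsUnit S.det := by
    have h : IsUnit (S * S.transpose).det := hS ▸ hSig.isUnit.map Matrix.detMonoidHom
    rw [Matrix.det_mul] at h
    exact isUnit_of_mul_isUnit_left h
  set y := S⁻¹.mulVec (w - w0) with hy
  have hSy : S.mulVec y = w - w0 := by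
    rw [hy, Matrix.mulVec_mulVec, Matrix.mul_nonsing_inv _ hdet, Matrix.one_mulVec]
  have hyy : ‖WithLp.toLp 2 y‖ ^ 2 ≤ γ ^ 2 := by
    have h : (w - w0) ⬝ᵥ Matrix.mulVec Sig⁻¹ (w - w0) = y ⬝ᵥ y := by
      rw [← hS, Matrix.mul_inv_rev, ← Matrix.mulVec_mulVec, ← hy,
        ← Matrix.transpose_nonsing_inv, Matrix.mulVec_transpose, dotProduct_comm,
        ← Matrix.dotProduct_mulVec, ← hy]
    have h2 : ‖WithLp.toLp 2 y‖ ^ 2 = y ⬝ᵥ y := by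
      rw [EuclideanSpace.real_norm_sq_eq]
      simp [dotProduct, sq]
    rw [h2, ← h]
    exact hw
  have hy' : ‖WithLp.toLp 2 y‖ ≤ γ := (sq_le_sq₀ (norm_nonneg _) hγ).1 hyy
  rw [← hSy, Matrix.dotProduct_mulVec]
  have := abs_real_inner_le_norm (WithLp.toLp 2 (Matrix.vecMul a S)) (WithLp.toLp 2 y)
  rw [EuclideanSpace.inner_toLp_toLp, star_trivial, dotProduct_comm] at this
  calc _ ≤ _ := this
    _ ≤ _ := by rw [mul_comm]; gcongr

end MatrixBounds

/-! ### Convex functions on boxes -/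

section Box

/-- A convex function on a set is bounded on a box in that set by its values at the vertices. -/
lemma ConvexOn.le_of_vertices_le {s : Set (ℝ × ℝ × ℝ)} {h : ℝ × ℝ × ℝ → ℝ} (hh : ConvexOn ℝ s h)
    {a a' b b' c c' C : ℝ}
    (hs : ({a, a'} : Set ℝ) ×ˢ (({b, b'} : Set ℝ) ×ˢ ({c, c'} : Set ℝ)) ⊆ s)
    (hC : ∀ x ∈ ({a, a'} : Set ℝ), ∀ y ∈ ({b, b'} : Set ℝ), ∀ z ∈ ({c, c'} : Set ℝ),
      h (x, y, z) ≤ C)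
    {x y z : ℝ} (hx : x ∈ Set.Icc a a') (hy : y ∈ Set.Icc b b') (hz : z ∈ Set.Icc c c') :
    h (x, y, z) ≤ C := by
  have hmem : (x, y, z) ∈ convexHull ℝ
      (({a, a'} : Set ℝ) ×ˢ (({b, b'} : Set ℝ) ×ˢ ({c, c'} : Set ℝ))) := by
    rw [convexHull_prod, convexHull_prod, convexHull_pair, convexHull_pair, convexHull_pair]
    exact ⟨Icc_subset_segment hx, Icc_subset_segment hy, Icc_subset_segment hz⟩
  obtain ⟨⟨x', y', z'⟩, ⟨hx', hy', hz'⟩, hle⟩ := hh.exists_ge_of_mem_convexHull hs hmem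
  exact hle.trans (hC x' hx' y' hy' z' hz')

lemma ConcaveOn.le_of_le_vertices {s : Set (ℝ × ℝ × ℝ)} {h : ℝ × ℝ × ℝ → ℝ} (hh : ConcaveOn ℝ s h)
    {a a' b b' c c' C : ℝ}
    (hs : ({a, a'} : Set ℝ) ×ˢ (({b, b'} : Set ℝ) ×ˢ ({c, c'} : Set ℝ)) ⊆ s)
    (hC : ∀ x ∈ ({a, a'} : Set ℝ), ∀ y ∈ ({b, b'} : Set ℝ), ∀ z ∈ ({c, c'} : Set ℝ),
      C ≤ h (x, y, z))
    {x y z : ℝ} (hx : x ∈ Set.Icc a a') (hy : y ∈ Set.Icc b b') (hz : z ∈ Set.Icc c c') :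
    C ≤ h (x, y, z) :=
  neg_le_neg_iff.1 (hh.neg.le_of_vertices_le hs
    (fun x hx y hy z hz => neg_le_neg (hC x hx y hy z hz)) hx hy hz)

end Box

lemma matInv_mul {m n : Type*} [Fintype m] [Fintype n] [DecidableEq m] [DecidableEq n]
    {J : Matrix m n ℝ} (hJ : Nonsingular J) : matInv J * J = 1 := by
  rw [matInv, dif_pos hJ]
  exact hJ.choose_spec.2

lemma mul_matInv {m n : Type*} [Fintype m] [Fintype n] [DecidableEq m] [DecidableEq n]
    {J : Matrix m n ℝ} (hJ : Nonsingular J) : J * matInv J = 1 := by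
  rw [matInv, dif_pos hJ]
  exact hJ.choose_spec.1

/-! ### Basis functions, the matrix `A` and the polytope -/

namespace PowerNetwork

variable {B L G D : Type*} (N : PowerNetwork B L G D)

lemma withSetpoints_mono (u : N.Dispatch) : Monotone (N.withSetpoints u) := by
  intro y y' h k
  unfold withSetpoints
  split_ifs with hk
  · exact le_rfl
  · exact h _

lemma differentiable_volt [Fintype B] [Fintype G] [DecidableEq B] (u : N.Dispatch) (k : B) :
    Differentiable ℝ fun x : N.XIdx → ℝ => N.volt x u k := by
  unfold volt withSetpoints
  split_ifs <;> fun_prop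

lemma differentiable_phi [Fintype B] [Fintype G] [DecidableEq B] (l : L) :
    Differentiable ℝ fun x : N.XIdx → ℝ => N.phi x l := by
  unfold phi angle
  split_ifs <;> fun_prop

lemma differentiable_psi [Fintype B] [Fintype L] [Fintype G] [DecidableEq B] (u : N.Dispatch) :
    Differentiable ℝ fun x : N.XIdx → ℝ => N.psi x u := by
  have hv := N.differentiable_volt u
  have hφ := N.differentiable_phi
  rw [differentiable_pi]
  rintro (i | l | l | k)
  · simp only [psi, imbalance, Sum.elim_inl]
    fun_prop
  · exact ((hv _).mul (hv _)).mul (hφ l).cos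
  · exact ((hv _).mul (hv _)).mul (hφ l).sin
  · exact (hv k).pow 2

/-- A state with prescribed PQ voltages in which one given line has a prescribed angle
difference. -/
lemma exists_state_phi_eq (y : N.PQ → ℝ) (l : L) (φ : ℝ) :
    ∃ x : N.XIdx → ℝ, (∀ u, N.volt x u = N.withSetpoints u y) ∧ N.phi x l = φ := by
  classical
  by_cases hf : N.fromBus l = N.ref
  · have ht : N.toBus l ≠ N.ref := fun h => N.fromBus_ne_toBus l (hf.trans h.symm)
    refine ⟨Sum.elim (fun k => if k.1 = N.toBus l then -φ else 0) (Sum.elim y 0),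
      fun u => rfl, ?_⟩
    simp [phi, angle, hf, ht]
  · have ht := (N.fromBus_ne_toBus l).symm
    refine ⟨Sum.elim (fun k => if k.1 = N.fromBus l then φ else 0) (Sum.elim y 0),
      fun u => rfl, ?_⟩
    simp [phi, angle, hf, ht]

lemma WithinLimits.vertices_subset {N : PowerNetwork B L G D} {lim : OperationalLimits B L G}
    {u : N.Dispatch} {zu zl : N.ZIdx → ℝ} (hlim : N.WithinLimits lim u zu zl) (l : L) :
    ({N.voltBound u zl (N.fromBus l), N.voltBound u zu (N.fromBus l)} : Set ℝ) ×ˢ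
      (({N.voltBound u zl (N.toBus l), N.voltBound u zu (N.toBus l)} : Set ℝ) ×ˢ
        ({zl (Sum.inl l), zu (Sum.inl l)} : Set ℝ)) ⊆ lim.lineRange N l :=
  Set.prod_mono (Set.pair_subset (hlim.v_lower _) (hlim.v_upper _))
    (Set.prod_mono (Set.pair_subset (hlim.v_lower _) (hlim.v_upper _))
      (Set.pair_subset (hlim.phi_lower _) (hlim.phi_upper _)))

-- Splitting `d k` equally among the generators at bus `k` works. Hence reactive balance at PV buses
-- is no constraint on the state.
open Finset in
lemma exists_genBus_sum_eq [Fintype G] [DecidableEq B] (d : B → ℝ) :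
    ∃ qg : G → ℝ, ∀ k, (∃ i, N.genBus i = k) → ∑ i, N.Cg k i * qg i = d k := by
  refine ⟨fun i => d (N.genBus i) / #{j | N.genBus j = N.genBus i}, fun k ⟨i, hi⟩ => ?_⟩
  have hcard : (#{j | N.genBus j = k} : ℝ) ≠ 0 :=
    Nat.cast_ne_zero.2 (Finset.card_ne_zero_of_mem (Finset.mem_filter.2 ⟨Finset.mem_univ i, hi⟩))
  calc ∑ i, N.Cg k i * (d (N.genBus i) / #{j | N.genBus j = N.genBus i})
      = ∑ i, if N.genBus i = k then d k / (#{j | N.genBus j = k} : ℝ) else 0 := by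
        refine Finset.sum_congr rfl fun i _ => ?_
        by_cases h : N.genBus i = k <;> simp [Cg, h]
    _ = d k := by
        rw [← Finset.sum_filter, Finset.sum_const, nsmul_eq_mul, mul_div_cancel₀ _ hcard]

section Matrices

variable [Fintype B] [Fintype G] [DecidableEq B]

lemma A_mulVec_inl (x : N.XIdx → ℝ) (l : L) : N.A.mulVec x (Sum.inl l) = N.phi x l := by
  have hsum : ∀ k : B, ∑ j : N.NS, (if k = j.1 then (1 : ℝ) else 0) * x (Sum.inl j)
      = N.angle x k := by
    intro k
    unfold angle
    split_ifs with hk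
    · rw [Finset.sum_eq_single ⟨k, hk⟩] <;> simp +contextual [Subtype.ext_iff, eq_comm]
    · refine Finset.sum_eq_zero fun j _ => ?_
      rw [if_neg (fun h : k = j.1 => hk (h ▸ j.2)), zero_mul]
  rw [phi, ← hsum, ← hsum, ← Finset.sum_sub_distrib]
  simp [A, Matrix.mulVec, dotProduct, Fintype.sum_sum_type, incidence, sub_mul]

lemma A_mulVec_inr (x : N.XIdx → ℝ) (j : N.PQ ⊕ Unit) :
    N.A.mulVec x (Sum.inr j) = x (Sum.inr j) := by
  simp only [A, Matrix.mulVec, dotProduct, Fintype.sum_sum_type (α₁ := N.NS),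
    Matrix.fromBlocks_apply₂₁, Matrix.fromBlocks_apply₂₂, Matrix.zero_apply, zero_mul,
    Finset.sum_const_zero, zero_add, Matrix.one_apply, ite_mul, one_mul,
    Finset.sum_ite_eq, Finset.mem_univ, if_true]

/-- Angles enter `ψ` only through differences along lines. This is what later makes `A` injective.
-/
lemma psi_eq_of_A_mulVec_eq (u : N.Dispatch) {x y : N.XIdx → ℝ}
    (h : N.A.mulVec x = N.A.mulVec y) : N.psi x u = N.psi y u := by
  have hφ : N.phi x = N.phi y := by
    funext l
    rw [← A_mulVec_inl, h, A_mulVec_inl]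
  have hr : ∀ j, x (Sum.inr j) = y (Sum.inr j) := fun j => by
    rw [← N.A_mulVec_inr x, h, A_mulVec_inr]
  simp only [psi, volt, imbalance, hφ, hr]

lemma convex_polytope (zu zl : N.ZIdx → ℝ) : Convex ℝ (N.polytope zu zl) :=
  (convex_Icc zl zu).linear_preimage (Matrix.mulVecLin N.A)

lemma volt_mem_Icc {zu zl : N.ZIdx → ℝ} {x : N.XIdx → ℝ} (hx : x ∈ N.polytope zu zl)
    (u : N.Dispatch) (k : B) :
    N.volt x u k ∈ Set.Icc (N.voltBound u zl k) (N.voltBound u zu k) := by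
  have h : ∀ j, x (Sum.inr j) ∈ Set.Icc (zl (Sum.inr j)) (zu (Sum.inr j)) := fun j =>
    N.A_mulVec_inr x j ▸ ⟨hx.1 _, hx.2 _⟩
  exact ⟨N.withSetpoints_mono u (fun j => (h _).1) k, N.withSetpoints_mono u (fun j => (h _).2) k⟩

end Matrices

variable [Fintype B] [Fintype L] [Fintype G] [DecidableEq B]

/-! ### Bounds on the residual over the polytope -/

section Residual

variable {N} {x0 : N.XIdx → ℝ} {u0 u : N.Dispatch} {lim : OperationalLimits B L G}
  {e : BoundingFunctions B L G} {zu zl : N.ZIdx → ℝ} {gu gl : N.PsiIdx → ℝ}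

/-- Neither `zl ≤ zu` nor a point of the polytope is available yet. Each envelope concerns a single
generator, line or bus, so a state matching the lower vertex in those arguments alone suffices. -/
lemma VertexInequalities.lower_le_upper (he : N.IsEnvelope x0 u0 lim e)
    (hlim : N.WithinLimits lim u zu zl) (hg : N.VertexInequalities e u zu zl gu gl) :
    gl ≤ gu := by
  rintro (i | l | l | k)
  · have h := he.encloses_p 0 u i (hlim.p i)
    exact (hg.p i).1.trans ((h.1.trans h.2).trans (hg.p i).2)
  · obtain ⟨x, hv, hφ⟩ := N.exists_state_phi_eq (fun k => zl (Sum.inr (Sum.inl k))) l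
      (zl (Sum.inl l))
    have h := he.encloses_cos x u l (by
      rw [hv, hφ]
      exact hlim.vertices_subset l ⟨Or.inl rfl, Or.inl rfl, Or.inl rfl⟩)
    rw [hv, hφ] at h
    have h' := hg.cos l _ (Or.inl rfl) _ (Or.inl rfl) _ (Or.inl rfl)
    exact h'.1.trans ((h.1.trans h.2).trans h'.2)
  · obtain ⟨x, hv, hφ⟩ := N.exists_state_phi_eq (fun k => zl (Sum.inr (Sum.inl k))) l
      (zl (Sum.inl l))
    have h := he.encloses_sin x u l (by
      rw [hv, hφ]
      exact hlim.vertices_subset l ⟨Or.inl rfl, Or.inl rfl, Or.inl rfl⟩)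
    rw [hv, hφ] at h
    have h' := hg.sin l _ (Or.inl rfl) _ (Or.inl rfl) _ (Or.inl rfl)
    exact h'.1.trans ((h.1.trans h.2).trans h'.2)
  · have h := he.encloses_v (Sum.elim 0 fun j => zl (Sum.inr j)) u k (hlim.v_lower k)
    have h' := hg.v k _ (Or.inl rfl)
    exact h'.1.trans ((h.1.trans h.2).trans h'.2)

lemma VertexInequalities.residual_mem_Icc (he : N.IsEnvelope x0 u0 lim e)
    (hlim : N.WithinLimits lim u zu zl) (hg : N.VertexInequalities e u zu zl gu gl)
    {x : N.XIdx → ℝ} (hx : x ∈ N.polytope zu zl) :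
    N.residual x0 u0 x u ∈ Set.Icc gl gu := by
  have hv := N.volt_mem_Icc hx u
  have hφ : ∀ l, N.phi x l ∈ Set.Icc (zl (Sum.inl l)) (zu (Sum.inl l)) := fun l =>
    N.A_mulVec_inl x l ▸ ⟨hx.1 _, hx.2 _⟩
  have hvlim : ∀ k, N.volt x u k ∈ Set.Icc (lim.vMin k) (lim.vMax k) := fun k =>
    ⟨(hlim.v_lower k).1.trans (hv k).1, (hv k).2.trans (hlim.v_upper k).2⟩
  have hline : ∀ l, (N.volt x u (N.fromBus l), N.volt x u (N.toBus l), N.phi x l) ∈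
      lim.lineRange N l := fun l =>
    ⟨hvlim _, hvlim _, (hlim.phi_lower l).1.trans (hφ l).1, (hφ l).2.trans (hlim.phi_upper l).2⟩
  suffices h : ∀ i, N.residual x0 u0 x u i ∈ Set.Icc (gl i) (gu i) from
    ⟨fun i => (h i).1, fun i => (h i).2⟩
  rintro (i | l | l | k)
  · have h := he.encloses_p x u i (hlim.p i)
    exact ⟨(hg.p i).1.trans h.1, h.2.trans (hg.p i).2⟩
  · have h := he.encloses_cos x u l (hline l)
    exact ⟨((he.concave_cos l).le_of_le_vertices (hlim.vertices_subset l)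
        (fun a ha b hb c hc => (hg.cos l a ha b hb c hc).1) (hv _) (hv _) (hφ l)).trans h.1,
      h.2.trans ((he.convex_cos l).le_of_vertices_le (hlim.vertices_subset l)
        (fun a ha b hb c hc => (hg.cos l a ha b hb c hc).2) (hv _) (hv _) (hφ l))⟩
  · have h := he.encloses_sin x u l (hline l)
    exact ⟨((he.concave_sin l).le_of_le_vertices (hlim.vertices_subset l)
        (fun a ha b hb c hc => (hg.sin l a ha b hb c hc).1) (hv _) (hv _) (hφ l)).trans h.1,
      h.2.trans ((he.convex_sin l).le_of_vertices_le (hlim.vertices_subset l)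
        (fun a ha b hb c hc => (hg.sin l a ha b hb c hc).2) (hv _) (hv _) (hφ l))⟩
  · have h := he.encloses_v x u k (hvlim k)
    have hl := hg.v k _ (Or.inl rfl)
    have hu := hg.v k _ (Or.inr rfl)
    exact ⟨((le_min hl.1 hu.1).trans ((he.concave_v k).min_le_of_mem_Icc (hlim.v_lower k)
        (hlim.v_upper k) (hv k))).trans h.1,
      h.2.trans (((he.convex_v k).le_max_of_mem_Icc (hlim.v_lower k)
        (hlim.v_upper k) (hv k)).trans (max_le hl.2 hu.2))⟩

end Residual

/-! ### The Jacobian, compactness, and zeros of `f` -/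

variable [Fintype D]

lemma Jf_eq (x0 : N.XIdx → ℝ) (u0 : N.Dispatch) : N.Jf x0 u0 = N.M * N.Jpsi x0 u0 := by
  classical
  have h : HasFDerivAt (fun x => N.f x u0 0)
      ((Matrix.mulVecLin N.M).toContinuousLinearMap.comp (fderiv ℝ (fun x => N.psi x u0) x0))
      x0 := by
    have := (Matrix.mulVecLin N.M).toContinuousLinearMap.hasFDerivAt.comp x0
      (N.differentiable_psi u0 x0).hasFDerivAt
    refine this.congr_of_eventuallyEq (Filter.Eventually.of_forall fun x => ?_)
    simp [f]
  rw [Jf, jacobian, h.fderiv, Jpsi, jacobian, ContinuousLinearMap.toLinearMap_comp,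
    LinearMap.toMatrix'_comp, LinearMap.coe_toContinuousLinearMap,
    ← Matrix.toLin'_apply', LinearMap.toMatrix'_toLin']

/-- If `A v = 0`, then `ψ` is constant along the direction `v`, so `J_ψ v = 0`, hence `J v = M J_ψ v
= 0` and `v = 0`. -/
lemma A_mulVec_injective {x0 : N.XIdx → ℝ} {u0 : N.Dispatch} (hJ : Nonsingular (N.Jf x0 u0)) :
    Function.Injective N.A.mulVec := by
  suffices h : ∀ v, N.A.mulVec v = 0 → v = 0 by
    intro x y hxy
    refine sub_eq_zero.1 (h _ ?_)
    rw [Matrix.mulVec_sub, sub_eq_zero]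
    exact hxy
  intro v hv
  have hψ : (N.Jpsi x0 u0).mulVec v = 0 := by
    have h1 : (N.Jpsi x0 u0).mulVec v = fderiv ℝ (fun x => N.psi x u0) x0 v := by
      rw [Jpsi, jacobian, LinearMap.toMatrix'_mulVec]
      rfl
    rw [h1, ← (N.differentiable_psi u0 x0).lineDeriv_eq_fderiv, lineDeriv]
    have : (fun t : ℝ => N.psi (x0 + t • v) u0) = fun _ => N.psi x0 u0 := by
      funext t
      apply N.psi_eq_of_A_mulVec_eq
      rw [Matrix.mulVec_add, Matrix.mulVec_smul, hv, smul_zero, add_zero]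
    rw [this, deriv_const]
  calc v = (matInv (N.Jf x0 u0) * N.Jf x0 u0).mulVec v := by rw [matInv_mul hJ, Matrix.one_mulVec]
    _ = 0 := by
      rw [Jf_eq, ← Matrix.mulVec_mulVec, ← Matrix.mulVec_mulVec, hψ, Matrix.mulVec_zero,
        Matrix.mulVec_zero]

lemma isCompact_polytope {x0 : N.XIdx → ℝ} {u0 : N.Dispatch} (hJ : Nonsingular (N.Jf x0 u0))
    (zu zl : N.ZIdx → ℝ) : IsCompact (N.polytope zu zl) := by
  have hemb : Topology.IsClosedEmbedding (Matrix.mulVecLin N.A) :=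
    LinearMap.isClosedEmbedding_of_injective (LinearMap.ker_eq_bot.2 (N.A_mulVec_injective hJ))
  exact hemb.isCompact_preimage (isCompact_Icc (a := zl) (b := zu))

lemma solvesPowerFlow_of_f_eq_zero {x : N.XIdx → ℝ} {u : N.Dispatch} {w : D ⊕ D → ℝ}
    (h : N.f x u w = 0) : N.SolvesPowerFlow x u w := by
  obtain ⟨qg, hqg⟩ := N.exists_genBus_sum_eq fun k =>
    (∑ i, N.Cd k i * w (Sum.inr i)) + ((∑ l, N.volt x u (N.fromBus l) * N.volt x u (N.toBus l) *
      (N.Gs k l * Real.sin (N.phi x l) - N.Bc k l * Real.cos (N.phi x l)))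
      - N.Bd k * N.volt x u k ^ 2)
  refine ⟨qg, fun k => ⟨?_, ?_⟩⟩
  · have hk := congrFun h (Sum.inl k)
    simp [f, M, R, psi, Matrix.mulVec, dotProduct, Fintype.sum_sum_type,
      Matrix.diagonal_apply] at hk
    have hsum : ∑ l, N.volt x u (N.fromBus l) * N.volt x u (N.toBus l) *
        (N.Gc k l * Real.cos (N.phi x l) + N.Bs k l * Real.sin (N.phi x l)) =
        (∑ l, N.Gc k l * (N.volt x u (N.fromBus l) * N.volt x u (N.toBus l) *
          Real.cos (N.phi x l))) + ∑ l, N.Bs k l * (N.volt x u (N.fromBus l) *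
          N.volt x u (N.toBus l) * Real.sin (N.phi x l)) := by
      rw [← Finset.sum_add_distrib]
      exact Finset.sum_congr rfl fun l _ => by ring
    rw [hsum]
    linear_combination hk
  -- At a PV bus `qg` was chosen to balance the equation; at a PQ bus no generator contributes and
  -- the equation is a component of `f = 0`.
  · by_cases hk : ∃ i, N.genBus i = k
    · rw [hqg k hk]; ring
    · have hk' := congrFun h (Sum.inr ⟨k, not_exists.1 hk⟩)
      simp [f, M, R, psi, Matrix.mulVec, dotProduct, Fintype.sum_sum_type,
        Matrix.diagonal_apply] at hk'
      have hsum : ∑ l, N.volt x u (N.fromBus l) * N.volt x u (N.toBus l) *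
          (N.Gs k l * Real.sin (N.phi x l) - N.Bc k l * Real.cos (N.phi x l)) =
          (∑ l, N.Gs k l * (N.volt x u (N.fromBus l) * N.volt x u (N.toBus l) *
            Real.sin (N.phi x l))) - ∑ l, N.Bc k l * (N.volt x u (N.fromBus l) *
            N.volt x u (N.toBus l) * Real.cos (N.phi x l)) := by
        rw [← Finset.sum_sub_distrib]
        exact Finset.sum_congr rfl fun l _ => by ring
      have hgen : ∑ i, N.Cg k i * qg i = 0 :=
        Finset.sum_eq_zero fun i _ => by simp [Cg, not_exists.1 hk i]
      rw [hsum, hgen]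
      linear_combination hk'

lemma f_eq_of_fixedPoint {x0 : N.XIdx → ℝ} {u0 : N.Dispatch} (hJ : Nonsingular (N.Jf x0 u0))
    {x : N.XIdx → ℝ} {u : N.Dispatch} {w : D ⊕ D → ℝ}
    (hx : -(matInv (N.Jf x0 u0)).mulVec (N.M.mulVec (N.residual x0 u0 x u) + N.R.mulVec w) = x) :
    N.f x u w = 0 := by
  have h : -(N.M.mulVec (N.residual x0 u0 x u) + N.R.mulVec w) = (N.Jf x0 u0).mulVec x := by
    conv_rhs => rw [← hx]
    rw [Matrix.mulVec_neg, Matrix.mulVec_mulVec, mul_matInv hJ, Matrix.one_mulVec]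
  rw [Jf_eq, ← Matrix.mulVec_mulVec, residual, Matrix.mulVec_sub] at h
  rw [f, ← neg_eq_zero]
  linear_combination h

end PowerNetwork

/-! ### The self-map of the polytope -/

theorem theorem1 {B L G D : Type*} [Fintype B] [Fintype L] [Fintype G] [Fintype D]
    [DecidableEq B] [DecidableEq D]
    (N : PowerNetwork B L G D)
    -- base point of the linearization, with nonsingular power flow Jacobian
    (x0 : N.XIdx → ℝ) (u0 : N.Dispatch) (hJ : Nonsingular (N.Jf x0 u0))
    -- uncertainty set; `S` is any square root of `Sig`, such as its Cholesky factor
    (w0 : D ⊕ D → ℝ) (Sig S : Matrix (D ⊕ D) (D ⊕ D) ℝ) (hSig : Sig.PosDef)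
    (hS : S * S.transpose = Sig) (γ : ℝ) (hγ : 0 ≤ γ)
    -- envelopes of the residual
    (lim : OperationalLimits B L G) (e : BoundingFunctions B L G)
    (he : N.IsEnvelope x0 u0 lim e)
    -- dispatch point, state bounds and residual bounds
    (u : N.Dispatch) (zu zl : N.ZIdx → ℝ) (gu gl : N.PsiIdx → ℝ)
    (hlim : N.WithinLimits lim u zu zl)
    (hg : N.VertexInequalities e u zu zl gu gl)
    (hupper : (posPartMat (N.K x0 u0)).mulVec gu + (negPartMat (N.K x0 u0)).mulVec gl
      + N.xiU x0 u0 w0 S γ ≤ zu)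
    (hlower : zl ≤ (posPartMat (N.K x0 u0)).mulVec gl + (negPartMat (N.K x0 u0)).mulVec gu
      + N.xiL x0 u0 w0 S γ) :
    ∀ w ∈ confidenceEllipsoid Sig w0 γ,
      ∃ x ∈ N.polytope zu zl, N.SolvesPowerFlow x u w := by
  intro w hw
  set P := matInv (N.Jf x0 u0) with hP
  -- `T` takes the residual vector, not the state, as its argument: any vector in `[gl, gu]` is sent
  -- into the polytope, so `T gl` witnesses nonemptiness before any state is known to lie there.
  let T : (N.PsiIdx → ℝ) → N.XIdx → ℝ := fun g => -P.mulVec (N.M.mulVec g + N.R.mulVec w)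
  have hAT : ∀ g, N.A.mulVec (T g) =
      (N.K x0 u0).mulVec g + -(N.A * P * N.R).mulVec w := by
    intro g
    simp only [T, PowerNetwork.K, Matrix.mulVec_neg, Matrix.mulVec_add, Matrix.neg_mulVec,
      Matrix.mulVec_mulVec, Matrix.mul_assoc, neg_add, ← hP]
  have hξ : ∀ i, -(N.A * P * N.R).mulVec w i ∈
      Set.Icc (N.xiL x0 u0 w0 S γ i) (N.xiU x0 u0 w0 S γ i) := by
    intro i
    have h := abs_le.1 (abs_dotProduct_sub_le_of_mem_confidenceEllipsoid hSig hS hγ hw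
      ((N.A * P * N.R) i))
    rw [dotProduct_sub] at h
    have hrow : Matrix.vecMul ((N.A * P * N.R) i) S = (N.A * P * N.R * S) i := rfl
    rw [hrow] at h
    simp only [PowerNetwork.xiL, PowerNetwork.xiU, Matrix.mulVec, ← hP]
    constructor <;> linarith [h.1, h.2]
  have hT : ∀ g ∈ Set.Icc gl gu, T g ∈ N.polytope zu zl := by
    intro g hgI
    constructor
    · rw [hAT]
      exact hlower.trans (add_le_add (le_mulVec_of_mem_Icc _ hgI) fun i => (hξ i).1)
    · rw [hAT]
      exact (add_le_add (mulVec_le_of_mem_Icc _ hgI) fun i => (hξ i).2).trans hupper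
  have hcont : Continuous fun x => T (N.residual x0 u0 x u) := by
    have hψ := (N.differentiable_psi u).continuous
    have hr : Continuous fun x => N.residual x0 u0 x u :=
      hψ.sub (continuous_const.matrix_mulVec continuous_id)
    exact (continuous_const.matrix_mulVec
      ((continuous_const.matrix_mulVec hr).add continuous_const)).neg
  obtain ⟨x, hx, hfix⟩ := (N.isCompact_polytope hJ zu zl).exists_fixedPoint_of_convex
    (N.convex_polytope zu zl) ⟨T gl, hT gl ⟨le_rfl, hg.lower_le_upper he hlim⟩⟩
    hcont.continuousOn fun x hx => hT _ (hg.residual_mem_Icc he hlim hx)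
  exact ⟨x, hx, N.solvesPowerFlow_of_f_eq_zero (N.f_eq_of_fixedPoint hJ hfix)⟩
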